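/- Let $m,n\ge 0$ be integers. A $1$-field $F$ on a set $\Omega\subset\mathbb{R}^d$ assigns to each $x\in\Omega$ a polynomial $F(x)(a)=f_x+\langle D_xf,a-x\rangle$, $a\in\mathbb{R}^d$, with $f_x\in\mathbb{R}$ and $D_xf\in\mathbb{R}^d$. Put $$\Gamma^1(F;\Omega)=\sup_{x\ne y\in\Omega}\;2\sup_{a\in\mathbb{R}^d}\frac{|F(x)(a)-F(y)(a)|}{\|x-a\|^2+\|y-a\|^2}\in[0,\infty].$$ For $\Omega_1\subset\Omega_2$, a $1$-field $G$ on $\Omega_2$ is a minimal Lipschitz extension (MLE) of a $1$-field $F$ on $\Omega_1$ if $\Gamma^1(G;\Omega_2)<\infty$, $G(x)=F(x)$ for all $x\in\Omega_1$, and $\Gamma^1(G;\Omega_2)=\Gamma^1(F;\Omega_1)$. For a map $u:\omega\to\mathbb{R}^n$ with $\omega\subset\mathbb{R}^m$ put $\mathrm{Lip}(u;\omega)=\sup_{x\ne y\in\omega}\|u(x)-u(y)\|/\|x-y\|\in[0,\infty]$; a map $v:\mathbb{R}^m\to\mathbb{R}^n$ is a minimal Lipschitz extension of $u$ if $v=u$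 on $\omega$ and $\mathrm{Lip}(v;\mathbb{R}^m)=\mathrm{Lip}(u;\omega)$. (Suprema over the empty set are $0$.) **Theorem.** Let $\omega\subset\mathbb{R}^m$ and let $u:\omega\to\mathbb{R}^n$ satisfy $\mathrm{Lip}(u;\omega)<\infty$. Let $F$ be the $1$-field on $\Omega=\{(x,0):x\in\omega\}\subset\mathbb{R}^m\times\mathbb{R}^n=\mathbb{R}^{m+n}$ given by $f_{(x,0)}=0$ and $D_{(x,0)}f=(0,u(x))$ for $x\in\omega$. Then: 1. for every MLE $G$ of $F$ on $\mathbb{R}^{m+n}$, with $G(z)(a)=g_z+\langle D_zg,a-z\rangle$, the map $\tilde u:\mathbb{R}^m\to\mathbb{R}^n$, $\tilde u(x)=(D_{(x,0)}g)^{(n)}$, where $v^{(n)}$ denotes the $\mathbb{R}^n$-component of $v\in\mathbb{R}^m\times\mathbb{R}^n$, is a minimal Lipschitz extension of $u$; 2. such an MLE $G$ of $F$ exists; 3. consequently $u$ has a minimal Lipschitz extension $\mathbb{R}^m\to\mathbb{R}^n$ (Kirszbraun's theorem). -/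

import Mathlib

open scoped ENNReal RealInnerProductSpace

noncomputable section

/-- A `1`-field on a subset `Ω` of a Euclidean space: to each `x ∈ Ω` it assigns the first degree
polynomial `a ↦ f_x + ⟨D_x f, a - x⟩`, given by the value `f_x` and the gradient `D_x f`. -/
structure OneField {E : Type*} [NormedAddCommGroup E] [InnerProductSpace ℝ E] (Ω : Set E) where
  /-- the number `f_x` -/
  val : Ω → ℝ
  /-- the vector `D_x f` -/
  grad : Ω → E

namespace OneField

variable {E : Type*} [NormedAddCommGroup E] [InnerProductSpace ℝ E]

/-- The polynomial `F(x)`, evaluated at `a`. -/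
def eval {Ω : Set E} (F : OneField Ω) (x : Ω) (a : E) : ℝ :=
  F.val x + ⟪F.grad x, a - (x : E)⟫

/-- `Γ¹(F; x, y) = 2 sup_a |F(x)(a) - F(y)(a)| / (‖x - a‖² + ‖y - a‖²)`, as an element of `[0, ∞]`
(meaningful for `x ≠ y`). -/
def gammaAt {Ω : Set E} (F : OneField Ω) (x y : Ω) : ℝ≥0∞ :=
  2 * ⨆ a : E, ENNReal.ofReal
    (|F.eval x a - F.eval y a| / (‖(x : E) - a‖ ^ 2 + ‖(y : E) - a‖ ^ 2))

/-- `Γ¹(F; Ω) = sup_{x ≠ y} Γ¹(F; x, y)`, as an element of `[0, ∞]`. -/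
def gamma {Ω : Set E} (F : OneField Ω) : ℝ≥0∞ :=
  ⨆ (x : Ω) (y : Ω) (_ : x ≠ y), F.gammaAt x y

/-- A Taylorian field: `Γ¹(F; Ω) < ∞`. -/
def IsTaylorian {Ω : Set E} (F : OneField Ω) : Prop :=
  F.gamma < ⊤

/-- `G` is a minimal Lipschitz extension of `F` (from `Ω₁` to `Ω₂`): `Ω₁ ⊆ Ω₂`, `G` is Taylorian,
`G(x) = F(x)` as polynomials for `x ∈ Ω₁`, and `Γ¹(G; Ω₂) = Γ¹(F; Ω₁)`. -/
structure IsMLE {Ω₁ Ω₂ : Set E} (F : OneField Ω₁) (G : OneField Ω₂) : Prop where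
  subset : Ω₁ ⊆ Ω₂
  taylorian : G.IsTaylorian
  extends_eval : ∀ (x : E) (hx : x ∈ Ω₁) (a : E), G.eval ⟨x, subset hx⟩ a = F.eval ⟨x, hx⟩ a
  gamma_eq : G.gamma = F.gamma

end OneField

/-- The Lipschitz constant `Lip(u) = sup_{x ≠ y} ‖u(x) - u(y)‖ / ‖x - y‖`, over the whole domain of
`u`, as an element of `[0, ∞]`. -/
def lipConst {X Y : Type*} [MetricSpace X] [MetricSpace Y] (u : X → Y) : ℝ≥0∞ :=
  ⨆ (x : X) (y : X) (_ : x ≠ y), ENNReal.ofReal (dist (u x) (u y) / dist x y)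

/-- `v : X → Y` is a minimal Lipschitz extension of `u : ω → Y`, where `ω ⊆ X`. -/
def IsMinimalLipschitzExtension {X Y : Type*} [MetricSpace X] [MetricSpace Y] {ω : Set X}
    (u : ω → Y) (v : X → Y) : Prop :=
  (∀ x : ω, v x = u x) ∧ lipConst v = lipConst u

/-- `ℝ^m × ℝ^n` with its Euclidean norm, that is `ℝ^{m+n}`. -/
abbrev EuclideanProd (m n : ℕ) : Type :=
  WithLp 2 (EuclideanSpace ℝ (Fin m) × EuclideanSpace ℝ (Fin n))

/-- `Ω = {(x, 0) : x ∈ ω}`. -/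
def liftDomain {m : ℕ} (n : ℕ) (ω : Set (EuclideanSpace ℝ (Fin m))) : Set (EuclideanProd m n) :=
  {p | p.fst ∈ ω ∧ p.snd = 0}

/-- The `1`-field associated with `u : ω → ℝ^n`: `f_{(x,0)} = 0` and `D_{(x,0)} f = (0, u(x))`. -/
def liftField {m n : ℕ} {ω : Set (EuclideanSpace ℝ (Fin m))}
    (u : ω → EuclideanSpace ℝ (Fin n)) : OneField (liftDomain n ω) where
  val _ := 0
  grad p := WithLp.toLp 2 (0, u ⟨(p : EuclideanProd m n).fst, p.2.1⟩)

/-- The map `x ↦ (D_{(x,0)} g)^{(n)}` from `ℝ^m` to `ℝ^n` of a `1`-field `G` on `ℝ^{m+n}`. -/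
def traceMap {m n : ℕ} (G : OneField (Set.univ : Set (EuclideanProd m n))) :
    EuclideanSpace ℝ (Fin m) → EuclideanSpace ℝ (Fin n) :=
  fun x => (G.grad ⟨WithLp.toLp 2 (x, 0), Set.mem_univ _⟩).snd

end

/-!
The `1`-field `F` attached to `u` satisfies `Γ¹(F) = Lip(u)`, and every `1`-field `G` has a
`Γ¹(G)`-Lipschitz gradient: the difference of the polynomials `G(x)` and `G(y)` is affine with
linear part `D_x g - D_y g`, and it suffices to compare its values at the two ends of a diameter of
the ball with diameter `[x, y]`. Hence the trace of an extension of `F` with the same `Γ¹` is a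
Lipschitz extension of `u` with the same constant, and all the rest follows from the existence of
minimal extensions of `1`-fields (`OneField.exists_isMLE`).

For the existence, let `κ = Γ¹(F)`. It is enough to find a function `Φ` on the whole space and
gradients `D` with `|Φ(a) - Φ(x) - ⟨D x, a - x⟩| ≤ κ/2 ‖a - x‖²` for all `x` and `a`, since then
the triangle inequality through `Φ(a)` gives `Γ¹ ≤ κ` for the field `(Φ, D)`. The field `F` bounds
an extension from above by the upper paraboloids `F(y)(a) + κ/2 ‖a - y‖²`, `y ∈ Ω`. Take for `Φ` the
supremum of all the downward paraboloids `a ↦ c + ⟨q, a - x⟩ - κ/2 ‖a - x‖²` lying below all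
these upper paraboloids; equivalently `Φ + κ/2 ‖·‖²` is the convex envelope of the infimum of the
upper paraboloids plus `κ/2 ‖·‖²`. By compactness the supremum is attained at each point `x`, and
the gradient of an optimal paraboloid serves as `D x`. The lower bound on `Φ` is then immediate. The
upper bound is the semiconcavity of a supremum of this kind: averages of translates of lower
paraboloids are lower paraboloids, up to a second order error. On `Ω` the hypothesis `Γ¹(F) ≤ κ`
says precisely that the lower paraboloids of `F` itself are competitors, and so they are the
optimal ones.
-/

/-! ### Finite bounds on `Γ¹` and on the Lipschitz constant -/

/-- Bounds by finite numbers determine the order of `[0, ∞]`. -/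
theorem ENNReal.le_of_forall_le_ofReal {A B : ℝ≥0∞}
    (h : ∀ κ : ℝ, 0 ≤ κ → B ≤ ENNReal.ofReal κ → A ≤ ENNReal.ofReal κ) : A ≤ B := by
  by_cases hB : B = ⊤
  · simp [hB]
  · simpa [ENNReal.ofReal_toReal hB] using h B.toReal ENNReal.toReal_nonneg (by
      rw [ENNReal.ofReal_toReal hB])

theorem lipConst_le_ofReal_iff {X Y : Type*} [MetricSpace X] [MetricSpace Y] {u : X → Y} {κ : ℝ}
    (hκ : 0 ≤ κ) :
    lipConst u ≤ ENNReal.ofReal κ ↔ ∀ x y, dist (u x) (u y) ≤ κ * dist x y := by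
  simp only [lipConst, iSup_le_iff]
  refine forall_congr' fun x => forall_congr' fun y => ⟨fun h => ?_, fun h hxy => ?_⟩
  · by_cases hxy : x = y
    · simp [hxy]
    · have := (ENNReal.ofReal_le_ofReal_iff hκ).1 (h hxy)
      rwa [div_le_iff₀ (dist_pos.2 hxy)] at this
  · apply ENNReal.ofReal_le_ofReal
    rwa [div_le_iff₀ (dist_pos.2 hxy)]

namespace OneField

section

variable {E : Type*} [NormedAddCommGroup E] [InnerProductSpace ℝ E] {Ω : Set E}

theorem gammaAt_le_ofReal_iff {F : OneField Ω} {κ : ℝ} (hκ : 0 ≤ κ) {x y : Ω} (hxy : x ≠ y) :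
    F.gammaAt x y ≤ ENNReal.ofReal κ ↔
      ∀ a, |F.eval x a - F.eval y a| ≤ κ / 2 * (‖(x : E) - a‖ ^ 2 + ‖(y : E) - a‖ ^ 2) := by
  have h2 : ENNReal.ofReal κ = 2 * ENNReal.ofReal (κ / 2) := by
    rw [show (2 : ℝ≥0∞) = ENNReal.ofReal 2 by simp, ← ENNReal.ofReal_mul (by norm_num)]
    congr 1
    ring
  rw [gammaAt, h2, ENNReal.mul_le_mul_iff_right (by norm_num) (by norm_num), iSup_le_iff]
  refine forall_congr' fun a => ?_
  have hpos : 0 < ‖(x : E) - a‖ ^ 2 + ‖(y : E) - a‖ ^ 2 := by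
    by_cases hx : (x : E) = a
    · have hy : (y : E) - a ≠ 0 := fun h => hxy (Subtype.ext (hx.trans (sub_eq_zero.1 h).symm))
      have := norm_pos_iff.2 hy
      positivity
    · have := norm_pos_iff.2 (sub_ne_zero.2 hx)
      positivity
  rw [ENNReal.ofReal_le_ofReal_iff (by positivity), div_le_iff₀ hpos]

theorem gamma_le_ofReal_iff {F : OneField Ω} {κ : ℝ} (hκ : 0 ≤ κ) :
    F.gamma ≤ ENNReal.ofReal κ ↔ ∀ x y a,
      |F.eval x a - F.eval y a| ≤ κ / 2 * (‖(x : E) - a‖ ^ 2 + ‖(y : E) - a‖ ^ 2) := by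
  simp only [gamma, iSup_le_iff]
  refine forall_congr' fun x => forall_congr' fun y => ⟨fun h => ?_, fun h hxy => ?_⟩
  · by_cases hxy : x = y
    · intro a
      simp only [hxy, sub_self, abs_zero]
      positivity
    · exact (gammaAt_le_ofReal_iff hκ hxy).1 (h hxy)
  · exact (gammaAt_le_ofReal_iff hκ hxy).2 h

/-- `Γ¹` bounds the Lipschitz constant of the gradients. -/
theorem norm_grad_sub_le {F : OneField Ω} {κ : ℝ} (hκ : 0 ≤ κ) (hF : F.gamma ≤ ENNReal.ofReal κ)
    (x y : Ω) : ‖F.grad x - F.grad y‖ ≤ κ * ‖(x : E) - y‖ := by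
  have hF := (gamma_le_ofReal_iff hκ).1 hF
  obtain ⟨x, hx⟩ := x
  obtain ⟨y, hy⟩ := y
  by_cases hxy : x = y
  · subst hxy
    simp
  set w := F.grad ⟨x, hx⟩ - F.grad ⟨y, hy⟩ with hw
  by_cases hw0 : w = 0
  · rw [hw0, norm_zero]
    positivity
  have hwpos : 0 < ‖w‖ := norm_pos_iff.2 hw0
  have hd : 0 < ‖x - y‖ := norm_pos_iff.2 (sub_ne_zero.2 hxy)
  -- `m ± h` are the ends of the diameter in direction `w` of the ball with diameter `[x, y]`
  set h : E := (‖x - y‖ / (2 * ‖w‖)) • w with hh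
  set m : E := (1 / 2 : ℝ) • (x + y) with hm
  have hnorm : ‖h‖ = ‖x - y‖ / 2 := by
    rw [hh, norm_smul, Real.norm_of_nonneg (by positivity)]
    field_simp
  have hinner : ⟪w, h⟫ = ‖w‖ * ‖x - y‖ / 2 := by
    rw [hh, real_inner_smul_right, real_inner_self_eq_norm_sq]
    field_simp
  have hball : ∀ k : E, ‖x - (m + k)‖ ^ 2 + ‖y - (m + k)‖ ^ 2 = ‖x - y‖ ^ 2 / 2 + 2 * ‖k‖ ^ 2 := by
    intro k
    have e1 : x - (m + k) = (1 / 2 : ℝ) • (x - y) - k := by rw [hm]; module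
    have e2 : y - (m + k) = -((1 / 2 : ℝ) • (x - y) + k) := by rw [hm]; module
    rw [e1, e2, norm_neg, @norm_sub_sq_real, @norm_add_sq_real, norm_smul]
    norm_num
    ring
  have h1 := (abs_le.1 (hF ⟨x, hx⟩ ⟨y, hy⟩ (m + h))).2
  have h2 := (abs_le.1 (hF ⟨x, hx⟩ ⟨y, hy⟩ (m + -h))).1
  simp only [hball, norm_neg, hnorm] at h1 h2
  have hdiff : F.eval ⟨x, hx⟩ (m + h) - F.eval ⟨y, hy⟩ (m + h)
      - (F.eval ⟨x, hx⟩ (m + -h) - F.eval ⟨y, hy⟩ (m + -h)) = 2 * ⟪w, h⟫ := by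
    simp only [eval, hw, inner_sub_left, inner_sub_right, inner_add_right, inner_neg_right]
    ring
  rw [hinner] at hdiff
  nlinarith

/-! ### Existence of minimal Lipschitz extensions of `1`-fields -/

/-- The jet `(c, q)` at `x`, as a pair in `ℝ × E`, is a minorant of `F` if the downward paraboloid
`z ↦ c + ⟨q, z - x⟩ - κ/2 ‖z - x‖²` lies below the upward paraboloids
`z ↦ F(y)(z) + κ/2 ‖z - y‖²` of `F`. -/
def IsMinorant (F : OneField Ω) (κ : ℝ) (x : E) (p : ℝ × E) : Prop :=
  ∀ (y : Ω) (z : E),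
    p.1 + ⟪p.2, z - x⟫ - κ / 2 * ‖z - x‖ ^ 2 ≤ F.eval y z + κ / 2 * ‖z - y‖ ^ 2

/-- A minorant at `x` is a minorant at every other point `x'`: expand its paraboloid at `x'`. -/
theorem IsMinorant.recenter {F : OneField Ω} {κ : ℝ} {x : E} {p : ℝ × E}
    (h : F.IsMinorant κ x p) (x' : E) :
    F.IsMinorant κ x'
      (p.1 + ⟪p.2, x' - x⟫ - κ / 2 * ‖x' - x‖ ^ 2, p.2 - κ • (x' - x)) := by
  intro y z
  refine le_trans (le_of_eq ?_) (h y z)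
  have e : z - x = (x' - x) + (z - x') := by abel
  rw [e, @norm_add_sq_real, inner_add_right, inner_sub_left, real_inner_smul_left]
  ring

/-- The compatibility condition `Γ¹(F) ≤ κ` says that the jets of `F` are minorants. -/
theorem isMinorant_of_gamma_le {F : OneField Ω} {κ : ℝ} (hκ : 0 ≤ κ)
    (hF : F.gamma ≤ ENNReal.ofReal κ) (x : Ω) : F.IsMinorant κ x (F.val x, F.grad x) := by
  intro y z
  have h := (abs_le.1 ((gamma_le_ofReal_iff hκ).1 hF x y z)).2
  rw [norm_sub_rev (x : E), norm_sub_rev (y : E)] at h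
  simp only [eval] at h ⊢
  linarith

theorem IsMinorant.fst_le {F : OneField Ω} {κ : ℝ} {x : Ω} {p : ℝ × E}
    (h : F.IsMinorant κ x p) : p.1 ≤ F.val x := by
  simpa [eval] using h x x

/-- An upward paraboloid is semiconcave: its average at two points `w + v` and `w - s v` with mean
`w` exceeds its value at `w` by the variance of the two points times `κ/2`. -/
theorem eval_add_sq_average (F : OneField Ω) (κ : ℝ) (y : Ω) (w v : E) {s : ℝ} (hs : 0 < s) :
    s / (1 + s) * (F.eval y (w + v) + κ / 2 * ‖w + v - y‖ ^ 2) +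
        1 / (1 + s) * (F.eval y (w - s • v) + κ / 2 * ‖w - s • v - y‖ ^ 2) =
      F.eval y w + κ / 2 * ‖w - y‖ ^ 2 + κ / 2 * (s * ‖v‖ ^ 2) := by
  have e1 : w + v - y = (w - y) + v := by abel
  have e2 : w - s • v - y = (w - y) - s • v := by abel
  simp only [eval, e1, e2]
  generalize w - (y : E) = d
  rw [@norm_add_sq_real, @norm_sub_sq_real, inner_add_right, inner_sub_right,
    real_inner_smul_right, real_inner_smul_right, norm_smul, Real.norm_of_nonneg hs.le]
  field_simp
  ring

/-- Averaging translates of minorants yields a minorant, after subtracting the semiconcavity error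
of the upward paraboloids. -/
theorem IsMinorant.average {F : OneField Ω} {κ : ℝ} {x v : E} {p p' : ℝ × E}
    (h : F.IsMinorant κ x p) (h' : F.IsMinorant κ (x + v) p') {s : ℝ} (hs : 0 < s) :
    F.IsMinorant κ x
      (s / (1 + s) * p'.1 + 1 / (1 + s) * (p.1 - s * ⟪p.2, v⟫ - κ / 2 * (s ^ 2 * ‖v‖ ^ 2))
          - κ / 2 * (s * ‖v‖ ^ 2),
        (s / (1 + s)) • p'.2 + (1 / (1 + s)) • (p.2 + (κ * s) • v)) := by
  intro y z
  have h1 := mul_le_mul_of_nonneg_left (h' y (z + v)) (show 0 ≤ s / (1 + s) by positivity)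
  have h2 := mul_le_mul_of_nonneg_left (h y (z - s • v)) (show 0 ≤ 1 / (1 + s) by positivity)
  have h3 := eval_add_sq_average F κ y z v hs
  have e1 : z + v - (x + v) = z - x := by abel
  have e2 : z - s • v - x = (z - x) - s • v := by abel
  rw [e1] at h1
  rw [e2, @norm_sub_sq_real, inner_sub_right, real_inner_smul_right, real_inner_smul_right,
    norm_smul, Real.norm_of_nonneg hs.le] at h2
  simp only [inner_add_left, real_inner_smul_left]
  have hcomm := real_inner_comm v (z - x)
  have key : s / (1 + s) * p'.1
        + 1 / (1 + s) * (p.1 - s * ⟪p.2, v⟫ - κ / 2 * (s ^ 2 * ‖v‖ ^ 2)) - κ / 2 * (s * ‖v‖ ^ 2)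
        + (s / (1 + s) * ⟪p'.2, z - x⟫ + 1 / (1 + s) * (⟪p.2, z - x⟫ + κ * s * ⟪v, z - x⟫))
        - κ / 2 * ‖z - x‖ ^ 2 =
      s / (1 + s) * (p'.1 + ⟪p'.2, z - x⟫ - κ / 2 * ‖z - x‖ ^ 2) +
        1 / (1 + s) * (p.1 + (⟪p.2, z - x⟫ - s * ⟪p.2, v⟫)
          - κ / 2 * (‖z - x‖ ^ 2 - 2 * (s * ⟪z - x, v⟫) + (s * ‖v‖) ^ 2))
        - κ / 2 * (s * ‖v‖ ^ 2) := by
    rw [hcomm]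
    field_simp
    ring
  linarith

/-- Among the minorants at `x` there is one with the greatest value at `x`. -/
theorem exists_isMinorant_forall_le [ProperSpace E] {F : OneField Ω} {κ : ℝ}
    (hκ : 0 ≤ κ) (hF : F.gamma ≤ ENNReal.ofReal κ) (hΩ : Ω.Nonempty) (x : E) :
    ∃ p, F.IsMinorant κ x p ∧ ∀ q, F.IsMinorant κ x q → q.1 ≤ p.1 := by
  obtain ⟨y, hy⟩ := hΩ
  obtain ⟨p₀, hp₀⟩ : ∃ p₀, F.IsMinorant κ x p₀ :=
    ⟨_, (isMinorant_of_gamma_le hκ hF ⟨y, hy⟩).recenter x⟩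
  set U : E → ℝ := fun z => F.eval ⟨y, hy⟩ z + κ / 2 * ‖z - y‖ ^ 2 with hU
  have hUc : Continuous U := by
    simp only [hU, eval]
    fun_prop
  obtain ⟨C, hC⟩ := (isCompact_closedBall x 1).bddAbove_image hUc.continuousOn
  have hC : ∀ z ∈ Metric.closedBall x 1, U z ≤ C := fun z hz => hC ⟨z, hz, rfl⟩
  set S : Set (ℝ × E) := {p | F.IsMinorant κ x p ∧ p₀.1 ≤ p.1} with hS
  have hclosed : IsClosed S := by
    have : S = (⋂ (y : Ω) (z : E), {p : ℝ × E |
        p.1 + ⟪p.2, z - x⟫ - κ / 2 * ‖z - x‖ ^ 2 ≤ F.eval y z + κ / 2 * ‖z - y‖ ^ 2}) ∩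
        {p | p₀.1 ≤ p.1} := by
      ext p
      simp [hS, IsMinorant]
    rw [this]
    refine IsClosed.inter (isClosed_iInter fun y => isClosed_iInter fun z => ?_) ?_
    · exact isClosed_le (by fun_prop) (by fun_prop)
    · exact isClosed_le (by fun_prop) (by fun_prop)
  have hsub : S ⊆ Set.Icc p₀.1 C ×ˢ Metric.closedBall (0 : E) (max 0 (C - p₀.1 + κ / 2)) := by
    rintro ⟨c, q⟩ ⟨hp, hc⟩
    refine ⟨⟨hc, ?_⟩, ?_⟩
    · have h1 := hp ⟨y, hy⟩ x
      have h2 := hC x (by simp)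
      simp only [sub_self, inner_zero_right, norm_zero] at h1
      simp only [hU] at h2
      linarith
    · rw [mem_closedBall_zero_iff]
      by_cases hq : q = 0
      · simp [hq]
      -- test at the point of the unit sphere around `x` in the direction of `q`
      have hq' : 0 < ‖q‖ := norm_pos_iff.2 hq
      have hn : ‖‖q‖⁻¹ • q‖ = 1 := by
        rw [norm_smul, norm_inv, norm_norm, inv_mul_cancel₀ hq'.ne']
      have h1 := hp ⟨y, hy⟩ (x + ‖q‖⁻¹ • q)
      have h2 := hC (x + ‖q‖⁻¹ • q) (by simp [hn])
      have h3 : ⟪q, ‖q‖⁻¹ • q⟫ = ‖q‖ := by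
        rw [real_inner_smul_right, real_inner_self_eq_norm_sq]
        field_simp
      simp only [add_sub_cancel_left, hn, h3] at h1
      simp only [hU] at h2
      simp only at hc
      exact le_max_of_le_right (by linarith)
  have hcompact : IsCompact S :=
    (isCompact_Icc.prod (isCompact_closedBall _ _)).of_isClosed_subset hclosed hsub
  obtain ⟨p, hp, hmax⟩ := hcompact.exists_isMaxOn ⟨p₀, hp₀, le_rfl⟩ continuous_fst.continuousOn
  refine ⟨p, hp.1, fun q hq => ?_⟩
  rcases le_total p₀.1 q.1 with h | h
  · exact hmax ⟨hq, h⟩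
  · exact h.trans hp.2

/-- A field whose polynomials all approximate one function `Φ` to second order with constant
`κ/2` has `Γ¹ ≤ κ`. -/
theorem gamma_le_of_abs_sub_le {F : OneField Ω} {κ : ℝ} (hκ : 0 ≤ κ) (Φ : E → ℝ)
    (h : ∀ x a, |F.eval x a - Φ a| ≤ κ / 2 * ‖a - x‖ ^ 2) : F.gamma ≤ ENNReal.ofReal κ := by
  rw [gamma_le_ofReal_iff hκ]
  intro x y a
  have hx := h x a
  have hy := h y a
  rw [abs_sub_comm, norm_sub_rev] at hy
  rw [norm_sub_rev] at hx
  have := abs_sub_le (F.eval x a) (Φ a) (F.eval y a)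
  linarith

/-- The two-sided second order estimate for optimal minorants. -/
theorem abs_sub_le_of_isMinorant {F : OneField Ω} {κ : ℝ} {p : E → ℝ × E}
    (hp : ∀ x, F.IsMinorant κ x (p x)) (hmax : ∀ x q, F.IsMinorant κ x q → q.1 ≤ (p x).1)
    (x a : E) : |(p x).1 + ⟪(p x).2, a - x⟫ - (p a).1| ≤ κ / 2 * ‖a - x‖ ^ 2 := by
  rw [abs_le]
  constructor
  · obtain ⟨v, rfl⟩ : ∃ v, a = x + v := ⟨a - x, by abel⟩
    rw [add_sub_cancel_left]
    -- averaging with weight `s / (1 + s)` costs a factor `1 + 2 s`, which tends to `1` with `s`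
    have key : ∀ s : ℝ, 0 < s → (p (x + v)).1 - (p x).1 - ⟪(p x).2, v⟫ - κ / 2 * ‖v‖ ^ 2 ≤
        s * (κ * ‖v‖ ^ 2) := by
      intro s hs
      have h := hmax x _ ((hp x).average (hp (x + v)) hs)
      simp only at h
      have hs' : 0 < 1 + s := by linarith
      have h2 : s * ((p (x + v)).1 - (p x).1 - ⟪(p x).2, v⟫ - κ / 2 * ‖v‖ ^ 2) ≤
          s * (s * (κ * ‖v‖ ^ 2)) := by
        have h3 := mul_le_mul_of_nonneg_left h hs'.le
        have e : (1 + s) * (s / (1 + s) * (p (x + v)).1 +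
            1 / (1 + s) * ((p x).1 - s * ⟪(p x).2, v⟫ - κ / 2 * (s ^ 2 * ‖v‖ ^ 2))
            - κ / 2 * (s * ‖v‖ ^ 2)) = s * (p (x + v)).1 +
            ((p x).1 - s * ⟪(p x).2, v⟫ - κ / 2 * (s ^ 2 * ‖v‖ ^ 2))
            - (1 + s) * (κ / 2 * (s * ‖v‖ ^ 2)) := by
          field_simp
        rw [e] at h3
        linarith
      exact le_of_mul_le_mul_left h2 hs
    have hlim : Filter.Tendsto (fun s : ℝ => s * (κ * ‖v‖ ^ 2)) (nhdsWithin 0 (Set.Ioi 0))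
        (nhds 0) := by
      have : Continuous fun s : ℝ => s * (κ * ‖v‖ ^ 2) := by fun_prop
      simpa using (this.tendsto 0).mono_left nhdsWithin_le_nhds
    have := ge_of_tendsto hlim (Filter.eventually_of_mem self_mem_nhdsWithin key)
    linarith
  · have := hmax a _ ((hp x).recenter a)
    simp only at this
    linarith

/-- An extension of a `1`-field cannot decrease `Γ¹`. -/
theorem gamma_le_of_extends {Ω₁ Ω₂ : Set E} {F : OneField Ω₁} {G : OneField Ω₂} (hsub : Ω₁ ⊆ Ω₂)
    (h : ∀ (x : E) (hx : x ∈ Ω₁) (a : E), G.eval ⟨x, hsub hx⟩ a = F.eval ⟨x, hx⟩ a) :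
    F.gamma ≤ G.gamma := by
  refine ENNReal.le_of_forall_le_ofReal fun κ hκ hG => (gamma_le_ofReal_iff hκ).2 ?_
  rintro ⟨x, hx⟩ ⟨y, hy⟩ a
  rw [← h x hx a, ← h y hy a]
  exact (gamma_le_ofReal_iff hκ).1 hG ⟨x, hsub hx⟩ ⟨y, hsub hy⟩ a

/-- Every Taylorian `1`-field on a subset of a Euclidean space has a minimal Lipschitz extension to
the whole space. -/
theorem exists_isMLE [ProperSpace E] {F : OneField Ω} (hF : F.IsTaylorian) :
    ∃ G : OneField (Set.univ : Set E), F.IsMLE G := by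
  obtain ⟨κ, hκ, hFκ⟩ : ∃ κ : ℝ, 0 ≤ κ ∧ F.gamma = ENNReal.ofReal κ :=
    ⟨F.gamma.toReal, ENNReal.toReal_nonneg, (ENNReal.ofReal_toReal hF.ne).symm⟩
  -- it suffices to extend without increasing `Γ¹`
  suffices h : ∃ G : OneField (Set.univ : Set E),
      (∀ x : Ω, G.val ⟨x, trivial⟩ = F.val x ∧ G.grad ⟨x, trivial⟩ = F.grad x) ∧
        G.gamma ≤ ENNReal.ofReal κ by
    obtain ⟨G, hGF, hG⟩ := h
    have hext : ∀ (x : E) (hx : x ∈ Ω) (a : E),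
        G.eval ⟨x, Set.subset_univ Ω hx⟩ a = F.eval ⟨x, hx⟩ a := by
      intro x hx a
      simp only [eval, (hGF ⟨x, hx⟩).1, (hGF ⟨x, hx⟩).2]
    exact ⟨G, Set.subset_univ Ω, hG.trans_lt ENNReal.ofReal_lt_top, hext,
      le_antisymm (hG.trans hFκ.ge) (gamma_le_of_extends _ hext)⟩
  rcases Ω.eq_empty_or_nonempty with hΩ | hΩ
  · refine ⟨⟨fun _ => 0, fun _ => 0⟩, fun x => absurd x.2 (by simp [hΩ]), ?_⟩
    refine gamma_le_of_abs_sub_le hκ (fun _ => 0) fun x a => ?_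
    simp only [eval, inner_zero_left, add_zero, sub_self, abs_zero]
    positivity
  -- on `Ω` the jets of `F` are chosen as the optimal minorants
  have hex : ∀ x : E, ∃ p, F.IsMinorant κ x p ∧ (∀ q, F.IsMinorant κ x q → q.1 ≤ p.1) ∧
      ∀ hx : x ∈ Ω, p = (F.val ⟨x, hx⟩, F.grad ⟨x, hx⟩) := by
    intro x
    by_cases hx : x ∈ Ω
    · exact ⟨_, isMinorant_of_gamma_le hκ hFκ.le ⟨x, hx⟩,
        fun q hq => IsMinorant.fst_le (x := ⟨x, hx⟩) hq, fun _ => rfl⟩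
    · obtain ⟨p, hp, hmax⟩ := exists_isMinorant_forall_le hκ hFκ.le hΩ x
      exact ⟨p, hp, hmax, fun h => absurd h hx⟩
  choose p hp hmax heq using hex
  refine ⟨⟨fun x => (p x).1, fun x => (p x).2⟩, fun x => ?_, ?_⟩
  · simp [heq x x.2]
  · exact gamma_le_of_abs_sub_le hκ (fun x => (p x).1) fun x a =>
      abs_sub_le_of_isMinorant hp hmax x a

end

/-- The gradient of a `1`-field at a point is determined by its polynomial there. -/
theorem grad_eq_of_eval_eq {E : Type*} [NormedAddCommGroup E] [InnerProductSpace ℝ E]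
    {Ω₁ Ω₂ : Set E} {F : OneField Ω₁} {G : OneField Ω₂} {x : E} {hx₁ : x ∈ Ω₁} {hx₂ : x ∈ Ω₂}
    (h : ∀ a, G.eval ⟨x, hx₂⟩ a = F.eval ⟨x, hx₁⟩ a) :
    G.grad ⟨x, hx₂⟩ = F.grad ⟨x, hx₁⟩ := by
  refine ext_inner_right ℝ fun v => ?_
  have h0 := h x
  have hv := h (x + v)
  simp only [eval, sub_self, inner_zero_right, add_sub_cancel_left] at h0 hv
  linarith

end OneField

/-! ### The `1`-field attached to a map and the trace of a `1`-field -/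

section

variable {m n : ℕ} {ω : Set (EuclideanSpace ℝ (Fin m))}

theorem lipConst_le_gamma_liftField (u : ω → EuclideanSpace ℝ (Fin n)) :
    lipConst u ≤ (liftField u).gamma := by
  refine ENNReal.le_of_forall_le_ofReal fun κ hκ h => (lipConst_le_ofReal_iff hκ).2 fun x y => ?_
  have := OneField.norm_grad_sub_le hκ h ⟨WithLp.toLp 2 (x, 0), x.2, rfl⟩
    ⟨WithLp.toLp 2 (y, 0), y.2, rfl⟩
  simpa [liftField, ← WithLp.toLp_sub, WithLp.prod_norm_eq_of_L2, Real.sqrt_sq, Subtype.dist_eq,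
    dist_eq_norm] using this

theorem gamma_liftField_le (u : ω → EuclideanSpace ℝ (Fin n)) :
    (liftField u).gamma ≤ lipConst u := by
  refine ENNReal.le_of_forall_le_ofReal fun κ hκ h => (OneField.gamma_le_ofReal_iff hκ).2 ?_
  rintro ⟨x, hx, hx0⟩ ⟨y, hy, hy0⟩ a
  have hu := (lipConst_le_ofReal_iff hκ).1 h ⟨x.fst, hx⟩ ⟨y.fst, hy⟩
  rw [Subtype.dist_eq, dist_eq_norm, dist_eq_norm] at hu
  have hdiff : (liftField u).eval ⟨x, hx, hx0⟩ a - (liftField u).eval ⟨y, hy, hy0⟩ a =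
      ⟪u ⟨x.fst, hx⟩ - u ⟨y.fst, hy⟩, a.snd⟫ := by
    simp [OneField.eval, liftField, WithLp.prod_inner_apply, hx0, hy0, inner_sub_left]
  have hx2 : ‖x - a‖ ^ 2 = ‖x.fst - a.fst‖ ^ 2 + ‖a.snd‖ ^ 2 := by
    simp [WithLp.prod_norm_sq_eq_of_L2, hx0]
  have hy2 : ‖y - a‖ ^ 2 = ‖y.fst - a.fst‖ ^ 2 + ‖a.snd‖ ^ 2 := by
    simp [WithLp.prod_norm_sq_eq_of_L2, hy0]
  have htri : ‖x.fst - y.fst‖ ≤ ‖x.fst - a.fst‖ + ‖y.fst - a.fst‖ := by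
    rw [norm_sub_rev y.fst]
    exact norm_sub_le_norm_sub_add_norm_sub _ _ _
  rw [hdiff]
  simp only [hx2, hy2]
  refine (abs_real_inner_le_norm _ _).trans ?_
  refine (mul_le_mul_of_nonneg_right hu (norm_nonneg _)).trans ?_
  have h1 := mul_le_mul_of_nonneg_right htri (norm_nonneg a.snd)
  -- `2 r s ≤ r² + s²` for each of the two terms on the right of `h1`
  have h2 : ‖x.fst - y.fst‖ * ‖a.snd‖ ≤
      1 / 2 * (‖x.fst - a.fst‖ ^ 2 + ‖a.snd‖ ^ 2 + (‖y.fst - a.fst‖ ^ 2 + ‖a.snd‖ ^ 2)) := by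
    linarith [two_mul_le_add_sq ‖x.fst - a.fst‖ ‖a.snd‖, two_mul_le_add_sq ‖y.fst - a.fst‖ ‖a.snd‖]
  calc κ * ‖x.fst - y.fst‖ * ‖a.snd‖ = κ * (‖x.fst - y.fst‖ * ‖a.snd‖) := by ring
    _ ≤ κ * _ := mul_le_mul_of_nonneg_left h2 hκ
    _ = _ := by ring

theorem gamma_liftField (u : ω → EuclideanSpace ℝ (Fin n)) :
    (liftField u).gamma = lipConst u :=
  le_antisymm (gamma_liftField_le u) (lipConst_le_gamma_liftField u)

theorem lipConst_traceMap_le (G : OneField (Set.univ : Set (EuclideanProd m n))) :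
    lipConst (traceMap G) ≤ G.gamma := by
  refine ENNReal.le_of_forall_le_ofReal fun κ hκ h => (lipConst_le_ofReal_iff hκ).2 fun x y => ?_
  have := OneField.norm_grad_sub_le hκ h ⟨WithLp.toLp 2 (x, 0), trivial⟩
    ⟨WithLp.toLp 2 (y, 0), trivial⟩
  have hfst : ‖(WithLp.toLp 2 (x, 0) - WithLp.toLp 2 (y, 0) : EuclideanProd m n)‖ = ‖x - y‖ := by
    simp [← WithLp.toLp_sub]
  rw [hfst] at this
  rw [dist_eq_norm, dist_eq_norm]
  refine le_trans ?_ this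
  rw [traceMap, traceMap, ← WithLp.sub_snd]
  exact WithLp.norm_snd_le _ _

/-- The Lipschitz constant of an extension is at least that of the given map. -/
theorem lipConst_le_of_extends {X Y : Type*} [MetricSpace X] [MetricSpace Y] {s : Set X}
    {u : s → Y} {v : X → Y} (h : ∀ x : s, v x = u x) : lipConst u ≤ lipConst v := by
  refine ENNReal.le_of_forall_le_ofReal fun κ hκ hv => (lipConst_le_ofReal_iff hκ).2 fun x y => ?_
  rw [← h x, ← h y]
  exact (lipConst_le_ofReal_iff hκ).1 hv x y

theorem isMinimalLipschitzExtension_traceMap {u : ω → EuclideanSpace ℝ (Fin n)}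
    {G : OneField (Set.univ : Set (EuclideanProd m n))} (hG : (liftField u).IsMLE G) :
    IsMinimalLipschitzExtension u (traceMap G) := by
  have hext : ∀ x : ω, traceMap G x = u x := by
    intro x
    have hx : (WithLp.toLp 2 ((x : EuclideanSpace ℝ (Fin m)), 0) : EuclideanProd m n) ∈
        liftDomain n ω := ⟨x.2, rfl⟩
    rw [traceMap, OneField.grad_eq_of_eval_eq (hG.extends_eval _ hx)]
    rfl
  refine ⟨hext, le_antisymm ?_ (lipConst_le_of_extends hext)⟩
  exact (lipConst_traceMap_le G).trans (hG.gamma_eq.trans (gamma_liftField u)).le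

end

theorem mainTheorem4 (m n : ℕ) (ω : Set (EuclideanSpace ℝ (Fin m)))
    (u : ω → EuclideanSpace ℝ (Fin n)) (hu : lipConst u < ⊤) :
    (∀ G : OneField (Set.univ : Set (EuclideanProd m n)),
      (liftField u).IsMLE G → IsMinimalLipschitzExtension u (traceMap G)) ∧
    (∃ G : OneField (Set.univ : Set (EuclideanProd m n)), (liftField u).IsMLE G) ∧
    (∃ v : EuclideanSpace ℝ (Fin m) → EuclideanSpace ℝ (Fin n),
      IsMinimalLipschitzExtension u v) := by
  obtain ⟨G, hG⟩ : ∃ G : OneField (Set.univ : Set (EuclideanProd m n)), (liftField u).IsMLE G :=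
    OneField.exists_isMLE (by rwa [OneField.IsTaylorian, gamma_liftField])
  exact ⟨fun _ => isMinimalLipschitzExtension_traceMap, ⟨G, hG⟩,
    ⟨traceMap G, isMinimalLipschitzExtension_traceMap hG⟩⟩
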